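/- Let $(X,\mathcal R)$, $\mathcal R=\{R_0,\dots,R_d\}$, be a symmetric association scheme of rank $d+1$ on a finite set $X$ with $|X|=n$: the $R_i$ are nonempty symmetric relations partitioning $X\times X$, $R_0$ is the diagonal, and for $(x,y)\in R_h$ the number of $z$ with $(x,z)\in R_i$ and $(z,y)\in R_j$ is a constant $p^h_{ij}$. Let $A_i$ be the $0/1$ matrix of $R_i$, and let $E_0=\frac1nJ,E_1,\dots,E_d$ be the minimal idempotents of the Bose--Mesner algebra, that is, the real matrix algebra generated by $A_0,\dots,A_d$ (here $J$ is the all-ones matrix). The multiplicity of a minimal idempotent is its rank, and its Krein parameters $q^h_{ij}$ are given by $E_i\circ E_j=\frac1n\sum_{h=0}^d q^h_{ij}E_h$, where $\circ$ is the entrywise product. Assume that the scheme has rank $d+1\ge 3$ and is partially metric with respect to $R_1$, with its relations ordered accordingly: the graph $\Gamma$ of $R_1$ is connected and $A_2$ is a polynomial of degree $2$ in $A_1$ (equivalently, $R_2$ is the distance-$2$ relation of $\Gamma$). Put $k=p^0_{11}$ (the valency of $\Gamma$), $a_1=p^1_{11}$ and $b_1=p^1_{12}$, and assume $k\ge 3$.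 Let $E=E_j$ be a minimal idempotent of multiplicity $m$, let $\theta$ be the real number with $A_1E=\theta E$, and assume $\theta\ne\pm k$. Then $$m\;\ge\; k-\frac{k(\theta+1)^2a_1(a_1+1)}{((a_1+1)\theta+k)^2+k\,a_1b_1},$$ with equality if and only if $E$ is a light tail, that is, the matrix $F=\sum_{h\ne 0}q^h_{jj}E_h$ is nonzero and $A_1F=\eta F$ for some real number $\eta$. -/

import Mathlib

open scoped Matrix

/-- A (symmetric) association scheme with rank `d + 1` on the finite set `X`: relations
`R_0, …, R_d` forming a partition of `X × X` into nonempty parts, where `R_0` is the diagonal, all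
relations are symmetric, and the number of `z` with `(x, z) ∈ R_i` and `(z, y) ∈ R_j` is a constant
`p h i j` (usually written `p^h_{ij}`) for all `(x, y) ∈ R_h`. Since the relations are nonempty, the
numbers `p h i j` are determined by the relations. -/
structure AssociationScheme (X : Type*) [Fintype X] (d : ℕ) where
  /-- `rel i x y` means that `(x, y) ∈ R_i`. -/
  rel : Fin (d + 1) → X → X → Prop
  rel_nonempty : ∀ i, ∃ x y, rel i x y
  rel_partition : ∀ x y, ∃! i, rel i x y
  rel_zero : ∀ x y, rel 0 x y ↔ x = y
  rel_symm : ∀ i x y, rel i x y → rel i y x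
  /-- The intersection numbers. -/
  p : Fin (d + 1) → Fin (d + 1) → Fin (d + 1) → ℕ
  card_inter : ∀ h i j x y, rel h x y → Set.ncard {z | rel i x z ∧ rel j z y} = p h i j

namespace AssociationScheme

section

variable {X : Type*} [Fintype X] {d : ℕ}

/-- The scheme graph of the relation `R_i` (meaningful for `i ≠ 0`, and then `x ≠ y` is automatic). -/
def graph (S : AssociationScheme X d) (i : Fin (d + 1)) : SimpleGraph X where
  Adj x y := x ≠ y ∧ S.rel i x y
  symm := ⟨fun _ _ h => ⟨h.1.symm, S.rel_symm _ _ _ h.2⟩⟩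
  loopless := ⟨fun _ h => h.1 rfl⟩

/-- The valency `k_i = p^0_{ii}` of the scheme graph of `R_i`. -/
def valency (S : AssociationScheme X d) (i : Fin (d + 1)) : ℕ := S.p 0 i i

open Classical in
/-- The relation matrix `A_i`. -/
noncomputable def relMatrix (S : AssociationScheme X d) (i : Fin (d + 1)) : Matrix X X ℝ :=
  Matrix.of fun x y => if S.rel i x y then 1 else 0

variable [DecidableEq X]

/-- `S` is `t`-partially metric with respect to the connected relation `R_1`, with its relations
ordered accordingly: `t ≤ d`, and `A_i` is a polynomial of degree `i` in `A_1` for `1 ≤ i ≤ t`. -/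
def IsTPartiallyMetric (S : AssociationScheme X d) (t : ℕ) : Prop :=
  t ≤ d ∧ (S.graph 1).Connected ∧
    ∀ i : Fin (d + 1), 1 ≤ (i : ℕ) → (i : ℕ) ≤ t →
      ∃ f : Polynomial ℝ, f.natDegree = (i : ℕ) ∧ S.relMatrix i = Polynomial.aeval (S.relMatrix 1) f

/-- `S` is partially metric with respect to `R_1`: it is `2`-partially metric, or it has rank `2`. -/
def IsPartiallyMetric (S : AssociationScheme X d) : Prop :=
  S.IsTPartiallyMetric 2 ∨ d = 1

/-- The Bose-Mesner algebra: the matrix algebra generated by the relation matrices. -/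
noncomputable def boseMesner (S : AssociationScheme X d) : Subalgebra ℝ (Matrix X X ℝ) :=
  Algebra.adjoin ℝ (Set.range S.relMatrix)

/-- `E` is a minimal idempotent of the Bose-Mesner algebra: a nonzero idempotent of that algebra
such that the only idempotents `G` of the algebra with `E G = G` are `0` and `E`. -/
def IsMinimalIdempotent (S : AssociationScheme X d) (E : Matrix X X ℝ) : Prop :=
  E ∈ S.boseMesner ∧ E * E = E ∧ E ≠ 0 ∧
    ∀ G ∈ S.boseMesner, G * G = G → E * G = G → G = 0 ∨ G = E

/-- `E_0, …, E_d` are the minimal idempotents of the scheme, ordered such that `n E_0 = J`. -/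
def IsIdempotentEnumeration (S : AssociationScheme X d)
    (E : Fin (d + 1) → Matrix X X ℝ) : Prop :=
  Function.Injective E ∧ Set.range E = {G | S.IsMinimalIdempotent G} ∧
    (Fintype.card X : ℝ) • E 0 = Matrix.of fun _ _ => 1

/-- `q h i j` (usually written `q^h_{ij}`) are the Krein parameters with respect to the
minimal idempotents `E_0, …, E_d`: `E_i ∘ E_j = (1 / n) ∑_h q^h_{ij} E_h` for the entrywise
product `∘`. (As the `E_h` are linearly independent, they are unique.) -/
def IsKreinParameters (E : Fin (d + 1) → Matrix X X ℝ)
    (q : Fin (d + 1) → Fin (d + 1) → Fin (d + 1) → ℝ) : Prop :=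
  ∀ i j, E i ⊙ E j = (1 / (Fintype.card X : ℝ)) • ∑ h, q h i j • E h

/-- The minimal idempotent `E = E_j` is a light tail: the matrix `F = ∑_{h ≠ 0} q^h_{jj} E_h`,
formed with the Krein parameters, is nonzero and `A_1 F = η F` for some real number `η`. -/
def IsLightTail (S : AssociationScheme X d) (E : Matrix X X ℝ) : Prop :=
  ∃ (Es : Fin (d + 1) → Matrix X X ℝ) (q : Fin (d + 1) → Fin (d + 1) → Fin (d + 1) → ℝ)
    (j : Fin (d + 1)),
    S.IsIdempotentEnumeration Es ∧ IsKreinParameters Es q ∧ Es j = E ∧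
      (∑ h with h ≠ 0, q h j j • Es h) ≠ 0 ∧
      ∃ η : ℝ, S.relMatrix 1 * (∑ h with h ≠ 0, q h j j • Es h) =
        η • ∑ h with h ≠ 0, q h j j • Es h

end

end AssociationScheme

/-! Put `F = tail E`, i.e. n(E ∘ E) − m E₀. By `tail_eq_sum` it is the matrix in the definition of a
light tail, and by `tail_posSemidef` (Schur product theorem) it is positive semidefinite.
`Matrix.PosSemidef.sq_trace_mul_le` gives tr(A₁F)² ≤ tr(F) tr(A₁²F), with equality iff A₁F = ηF for
some η. Since A₁² is a combination of A₀, A₁, A₂, the three traces involve only the entries of E on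
R₀, R₁, R₂, and A₁E = θE determines these from m and θ. By `tail_defect_eq` the Cauchy–Schwarz
defect is then m minus the claimed bound, times a factor that is positive because θ ≠ ±k. -/

namespace AssociationScheme

/-! ### The Bose–Mesner algebra in coordinates: matrices as functions of the relation index. -/

variable {X : Type*} [Fintype X] {d : ℕ} (S : AssociationScheme X d)

/-- The index of the relation that contains `(x, y)`. -/
noncomputable def idx (x y : X) : Fin (d + 1) := (S.rel_partition x y).choose

lemma rel_iff_idx {i : Fin (d + 1)} {x y : X} : S.rel i x y ↔ S.idx x y = i :=
  ⟨fun h => ((S.rel_partition x y).choose_spec.2 i h).symm,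
    fun h => h ▸ (S.rel_partition x y).choose_spec.1⟩

lemma idx_eq_zero {x y : X} : S.idx x y = 0 ↔ x = y := by
  rw [← rel_iff_idx, rel_zero]

lemma idx_self (x : X) : S.idx x x = 0 := S.idx_eq_zero.2 rfl

lemma idx_comm (x y : X) : S.idx x y = S.idx y x :=
  S.rel_iff_idx.1 (S.rel_symm _ _ _ (S.rel_iff_idx.2 rfl))

lemma exists_idx_eq (i : Fin (d + 1)) : ∃ x y, S.idx x y = i := by
  obtain ⟨x, y, h⟩ := S.rel_nonempty i
  exact ⟨x, y, S.rel_iff_idx.1 h⟩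

lemma nonempty_points (S : AssociationScheme X d) : Nonempty X := ⟨(S.rel_nonempty 0).choose⟩

lemma card_idx (i j : Fin (d + 1)) (x y : X) :
    (Finset.univ.filter fun z => S.idx x z = i ∧ S.idx z y = j).card = S.p (S.idx x y) i j := by
  rw [← S.card_inter _ i j x y (S.rel_iff_idx.2 rfl), ← Set.ncard_coe_finset]
  congr 1
  ext z
  simp [rel_iff_idx]

/-- The linear combination `∑ i, f i • A_i` of the relation matrices. -/
noncomputable def ofFun : (Fin (d + 1) → ℝ) →ₗ[ℝ] Matrix X X ℝ where
  toFun f := Matrix.of fun x y => f (S.idx x y)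
  map_add' _ _ := rfl
  map_smul' _ _ := rfl

@[simp] lemma ofFun_apply (f : Fin (d + 1) → ℝ) (x y : X) : S.ofFun f x y = f (S.idx x y) := rfl

lemma relMatrix_apply (i : Fin (d + 1)) (x y : X) :
    S.relMatrix i x y = if S.idx x y = i then 1 else 0 := by
  simp [relMatrix, rel_iff_idx]

lemma relMatrix_eq_ofFun (i : Fin (d + 1)) : S.relMatrix i = S.ofFun (Pi.single i 1) := by
  ext x y
  simp [relMatrix_apply, Pi.single_apply]

lemma ofFun_injective : Function.Injective S.ofFun := by
  intro f g h
  funext i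
  obtain ⟨x, y, rfl⟩ := S.exists_idx_eq i
  exact congrFun (congrFun h x) y

lemma ofFun_eq_sum (f : Fin (d + 1) → ℝ) : S.ofFun f = ∑ i, f i • S.relMatrix i := by
  ext x y
  simp [Matrix.sum_apply, relMatrix_apply]

lemma ofFun_transpose (f : Fin (d + 1) → ℝ) : (S.ofFun f)ᵀ = S.ofFun f := by
  ext x y
  simp [S.idx_comm y x]

lemma ofFun_hadamard (f g : Fin (d + 1) → ℝ) : S.ofFun f ⊙ S.ofFun g = S.ofFun (f * g) := rfl

lemma ofFun_one_eq : S.ofFun 1 = Matrix.of fun _ _ => 1 := rfl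

lemma relMatrix_mul_ofFun (i : Fin (d + 1)) (f : Fin (d + 1) → ℝ) :
    S.relMatrix i * S.ofFun f = S.ofFun fun h => ∑ j, (S.p h i j : ℝ) * f j := by
  ext x y
  simp only [Matrix.mul_apply, relMatrix_apply, ofFun_apply, ← card_idx]
  have h (z : X) : (if S.idx x z = i then (1 : ℝ) else 0) * f (S.idx z y) =
      ∑ j, if S.idx x z = i ∧ S.idx z y = j then f j else 0 := by
    by_cases hz : S.idx x z = i <;> simp [hz]
  simp only [h]
  rw [Finset.sum_comm]
  refine Finset.sum_congr rfl fun j _ => ?_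
  rw [← Finset.sum_filter, Finset.sum_const, nsmul_eq_mul]

lemma trace_ofFun (f : Fin (d + 1) → ℝ) : (S.ofFun f).trace = Fintype.card X * f 0 := by
  simp [Matrix.trace, idx_self]

lemma ofFun_mul_mem_range (f g : Fin (d + 1) → ℝ) : ∃ h, S.ofFun f * S.ofFun g = S.ofFun h := by
  rw [S.ofFun_eq_sum f, Finset.sum_mul]
  simp only [smul_mul_assoc, relMatrix_mul_ofFun, ← map_smul, ← map_sum]
  exact ⟨_, rfl⟩

/-- Symmetric matrices whose product is again symmetric commute. -/
lemma ofFun_mul_comm (f g : Fin (d + 1) → ℝ) :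
    S.ofFun f * S.ofFun g = S.ofFun g * S.ofFun f := by
  obtain ⟨h, hh⟩ := S.ofFun_mul_mem_range f g
  have h1 := congrArg Matrix.transpose hh
  rw [Matrix.transpose_mul, ofFun_transpose, ofFun_transpose, ofFun_transpose] at h1
  rw [hh, h1]

section

variable [DecidableEq X]

lemma one_eq_ofFun : (1 : Matrix X X ℝ) = S.ofFun (Pi.single 0 1) := by
  ext x y
  simp [Matrix.one_apply, Pi.single_apply, idx_eq_zero]

/-- The span of the relation matrices is closed under products, so it is already the generated
algebra. -/
lemma mem_boseMesner_iff {M : Matrix X X ℝ} : M ∈ S.boseMesner ↔ ∃ f, M = S.ofFun f := by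
  constructor
  · intro hM
    induction hM using Algebra.adjoin_induction with
    | mem x hx => obtain ⟨i, rfl⟩ := hx; exact ⟨_, S.relMatrix_eq_ofFun i⟩
    | algebraMap r =>
      exact ⟨r • Pi.single 0 1, by rw [map_smul, ← one_eq_ofFun, Algebra.algebraMap_eq_smul_one]⟩
    | add x y _ _ hx hy =>
      obtain ⟨f, rfl⟩ := hx
      obtain ⟨g, rfl⟩ := hy
      exact ⟨f + g, (map_add _ _ _).symm⟩
    | mul x y _ _ hx hy =>
      obtain ⟨f, rfl⟩ := hx
      obtain ⟨g, rfl⟩ := hy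
      exact S.ofFun_mul_mem_range f g
  · rintro ⟨f, rfl⟩
    rw [ofFun_eq_sum]
    exact sum_mem fun i _ => S.boseMesner.smul_mem (Algebra.subset_adjoin (Set.mem_range_self i)) _

lemma relMatrix_mem (i : Fin (d + 1)) : S.relMatrix i ∈ S.boseMesner :=
  Algebra.subset_adjoin ⟨i, rfl⟩

variable {S}

lemma mul_comm_of_mem {M N : Matrix X X ℝ} (hM : M ∈ S.boseMesner) (hN : N ∈ S.boseMesner) :
    M * N = N * M := by
  obtain ⟨f, rfl⟩ := S.mem_boseMesner_iff.1 hM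
  obtain ⟨g, rfl⟩ := S.mem_boseMesner_iff.1 hN
  exact S.ofFun_mul_comm f g

lemma isHermitian_of_mem {M : Matrix X X ℝ} (hM : M ∈ S.boseMesner) : M.IsHermitian := by
  obtain ⟨f, rfl⟩ := S.mem_boseMesner_iff.1 hM
  rw [Matrix.IsHermitian, Matrix.conjTranspose_eq_transpose_of_trivial, ofFun_transpose]

lemma hadamard_mem {M N : Matrix X X ℝ} (hM : M ∈ S.boseMesner) (hN : N ∈ S.boseMesner) :
    M ⊙ N ∈ S.boseMesner := by
  obtain ⟨f, rfl⟩ := S.mem_boseMesner_iff.1 hM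
  obtain ⟨g, rfl⟩ := S.mem_boseMesner_iff.1 hN
  exact S.mem_boseMesner_iff.2 ⟨_, S.ofFun_hadamard f g⟩

variable (S)

lemma finrank_boseMesner : Module.finrank ℝ S.boseMesner = d + 1 := by
  have h : Subalgebra.toSubmodule S.boseMesner = LinearMap.range S.ofFun := by
    ext M
    simp [mem_boseMesner_iff, eq_comm]
  rw [← Subalgebra.finrank_toSubmodule, h, LinearMap.finrank_range_of_inj S.ofFun_injective]
  simp

end

end AssociationScheme

/-! ### Idempotents and spectral projections of real symmetric matrices. -/

namespace Matrix

variable {ι : Type*} [Fintype ι] [DecidableEq ι]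

lemma trace_eq_rank_of_idempotent {K : Type*} [Field K] {G : Matrix ι ι K} (hG : G * G = G) :
    G.trace = G.rank := by
  have h : IsIdempotentElem G.toLin' := by
    rw [IsIdempotentElem, Module.End.mul_eq_comp, ← Matrix.toLin'_mul, hG]
  rw [← Matrix.trace_toLin'_eq, (LinearMap.IsIdempotentElem.isProj_range _ h).trace, Matrix.rank, Matrix.toLin'_apply']

lemma eq_zero_of_rank_eq_zero {K : Type*} [Field K] {G : Matrix ι ι K} (h : G.rank = 0) :
    G = 0 := by
  rw [Matrix.rank, Submodule.finrank_eq_zero, LinearMap.range_eq_bot] at h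
  exact Matrix.toLin'.map_eq_zero_iff.1 h

lemma IsHermitian.aeval_congr {A : Matrix ι ι ℝ} (hA : A.IsHermitian) {p q : Polynomial ℝ}
    (h : (spectrum ℝ A).EqOn p.eval q.eval) : Polynomial.aeval A p = Polynomial.aeval A q := by
  have hA' : IsSelfAdjoint A := hA
  rw [← cfc_polynomial p A hA', ← cfc_polynomial q A hA', cfc_congr h]

/-- A real symmetric matrix is a linear combination of its spectral projections, which are
idempotent polynomials in it. -/
lemma IsHermitian.mem_span_idempotents {A : Matrix ι ι ℝ} (hA : A.IsHermitian)
    {B : Subalgebra ℝ (Matrix ι ι ℝ)} (hB : A ∈ B) :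
    A ∈ Submodule.span ℝ {G | G ∈ B ∧ G * G = G} := by
  classical
  set s := A.finite_real_spectrum.toFinset with hs
  have heval {x y : ℝ} (hx : x ∈ s) (hy : y ∈ s) :
      (Lagrange.basis s id x).eval y = if x = y then 1 else 0 := by
    split_ifs with h
    · subst h
      exact Lagrange.eval_basis_self (v := id) Function.injective_id.injOn hx
    · exact Lagrange.eval_basis_of_ne (v := id) h hy
  have key : A = ∑ x ∈ s, x • Polynomial.aeval A (Lagrange.basis s id x) := by
    have h : Polynomial.aeval A (Polynomial.X : Polynomial ℝ) =
        Polynomial.aeval A (∑ x ∈ s, x • Lagrange.basis s id x) := by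
      refine hA.aeval_congr fun y hy => ?_
      have hy' : y ∈ s := by simpa [hs] using hy
      simp only [Polynomial.eval_X, Polynomial.eval_finsetSum, Polynomial.eval_smul]
      rw [Finset.sum_congr rfl fun x hx => by rw [heval hx hy']]
      simp [hy']
    simpa using h
  have hmem {x : ℝ} (hx : x ∈ s) :
      Polynomial.aeval A (Lagrange.basis s id x) ∈ {G | G ∈ B ∧ G * G = G} := by
    refine ⟨Algebra.adjoin_le (Set.singleton_subset_iff.2 hB)
      (Polynomial.aeval_mem_adjoin_singleton ℝ A), ?_⟩
    rw [← map_mul]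
    refine hA.aeval_congr fun y hy => ?_
    have hy' : y ∈ s := by simpa [hs] using hy
    simp only [Polynomial.eval_mul, heval hx hy']
    simp
  rw [key]
  exact sum_mem fun x hx => Submodule.smul_mem _ _ (Submodule.subset_span (hmem hx))

end Matrix

/-! ### The minimal idempotents form a basis; Krein parameters exist. -/

namespace AssociationScheme

variable {X : Type*} [Fintype X] [DecidableEq X] {d : ℕ} {S : AssociationScheme X d}

/-- The product is an idempotent below both factors; were it nonzero, minimality would make it equal
to each. -/
lemma IsMinimalIdempotent.mul_eq_zero {E G : Matrix X X ℝ} (hE : S.IsMinimalIdempotent E)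
    (hG : S.IsMinimalIdempotent G) (hne : E ≠ G) : E * G = 0 := by
  have hc := mul_comm_of_mem hE.1 hG.1
  have hm : E * G ∈ S.boseMesner := mul_mem hE.1 hG.1
  have hi : E * G * (E * G) = E * G := by
    rw [mul_assoc, ← mul_assoc G, ← hc, mul_assoc E G G, hG.2.1, ← mul_assoc, hE.2.1]
  rcases hE.2.2.2 _ hm hi (by rw [← mul_assoc, hE.2.1]) with h | h
  · exact h
  rcases hG.2.2.2 _ hm hi (by rw [hc, ← mul_assoc, hG.2.1]) with h' | h'
  · exact h'
  · exact absurd (h.symm.trans h') hne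

variable (S) in
lemma linearIndependent_minimalIdempotents :
    LinearIndependent ℝ (Subtype.val : {G // S.IsMinimalIdempotent G} → Matrix X X ℝ) := by
  rw [linearIndependent_iff']
  intro s g h i hi
  have h1 := congrArg (i.1 * ·) h
  simp only [Finset.mul_sum, mul_zero, mul_smul_comm] at h1
  rw [Finset.sum_eq_single_of_mem i hi fun j _ hj => by
    rw [i.2.mul_eq_zero j.2 fun h => hj (Subtype.ext h.symm), smul_zero], i.2.2.1] at h1
  exact (smul_eq_zero.1 h1).resolve_right i.2.2.2.1

/-- Induction on the rank: a non-minimal G splits as H + (G − H) with both summands nonzero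
idempotents, and their ranks, being traces, add up to that of G. -/
lemma mem_span_of_idempotent (r : ℕ) : ∀ G ∈ S.boseMesner, G * G = G → G.rank = r →
    G ∈ Submodule.span ℝ {G | S.IsMinimalIdempotent G} := by
  induction r using Nat.strong_induction_on with
  | _ r ih =>
    intro G hG hi hr
    by_cases h0 : G = 0
    · exact h0 ▸ zero_mem _
    by_cases hmin : S.IsMinimalIdempotent G
    · exact Submodule.subset_span hmin
    obtain ⟨H, hH, hHi, hGH, hH0, hHG⟩ : ∃ H ∈ S.boseMesner, H * H = H ∧ G * H = H ∧
        H ≠ 0 ∧ H ≠ G := by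
      by_contra! hcon
      refine hmin ⟨hG, hi, h0, fun H hH hHi hGH => ?_⟩
      by_contra! h
      exact h.2 (hcon H hH hHi hGH h.1)
    have hHG' : H * G = H := by rw [mul_comm_of_mem hH hG, hGH]
    have hKi : (G - H) * (G - H) = G - H := by
      rw [sub_mul, mul_sub, mul_sub, hi, hGH, hHG', hHi, sub_self, sub_zero]
    have hrank : H.rank + (G - H).rank = G.rank := by
      have := Matrix.trace_sub G H
      rw [Matrix.trace_eq_rank_of_idempotent hKi, Matrix.trace_eq_rank_of_idempotent hi,
        Matrix.trace_eq_rank_of_idempotent hHi] at this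
      have h' : (H.rank + (G - H).rank : ℝ) = G.rank := by linarith
      exact_mod_cast h'
    have h1 : H.rank ≠ 0 := fun h => hH0 (Matrix.eq_zero_of_rank_eq_zero h)
    have h2 : (G - H).rank ≠ 0 := fun h =>
      hHG (sub_eq_zero.1 (Matrix.eq_zero_of_rank_eq_zero h)).symm
    have := add_mem (ih _ (by omega) H hH hHi rfl)
      (ih _ (by omega) (G - H) (sub_mem hG hH) hKi rfl)
    rwa [add_sub_cancel] at this

variable (S) in
lemma span_minimalIdempotents :
    Submodule.span ℝ {G | S.IsMinimalIdempotent G} = Subalgebra.toSubmodule S.boseMesner := by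
  refine le_antisymm (Submodule.span_le.2 fun G hG => hG.1) fun M hM => ?_
  refine Submodule.span_le.2 ?_ ((isHermitian_of_mem hM).mem_span_idempotents hM)
  exact fun G hG => mem_span_of_idempotent _ G hG.1 hG.2 rfl

variable (S) in
lemma exists_equiv_minimalIdempotents :
    Nonempty (Fin (d + 1) ≃ {G // S.IsMinimalIdempotent G}) := by
  have hli := S.linearIndependent_minimalIdempotents
  have : Finite {G // S.IsMinimalIdempotent G} := hli.finite
  have := Fintype.ofFinite {G // S.IsMinimalIdempotent G}
  have h := finrank_span_eq_card hli
  rw [Subtype.range_coe_subtype, span_minimalIdempotents, Subalgebra.finrank_toSubmodule,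
    finrank_boseMesner] at h
  exact ⟨(Fintype.equivFinOfCardEq h.symm).symm⟩

variable (S) in
lemma allOnes_mem : (Matrix.of fun _ _ => 1 : Matrix X X ℝ) ∈ S.boseMesner :=
  S.mem_boseMesner_iff.2 ⟨1, rfl⟩

lemma mul_allOnes {M : Matrix X X ℝ} (hM : M ∈ S.boseMesner) :
    ∃ c : ℝ, M * (Matrix.of fun _ _ => 1) = c • Matrix.of fun _ _ => 1 := by
  obtain ⟨f, rfl⟩ := S.mem_boseMesner_iff.1 hM
  obtain ⟨g, hg⟩ := S.ofFun_mul_mem_range f 1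
  refine ⟨g 0, ?_⟩
  rw [← S.ofFun_one_eq]
  ext x y
  have h1 := congrFun (congrFun hg x) x
  simp only [Matrix.mul_apply, ofFun_apply, Pi.one_apply, idx_self] at h1
  simp [Matrix.mul_apply, ← h1]

variable (S) in
lemma isMinimalIdempotent_allOnes :
    S.IsMinimalIdempotent ((1 / (Fintype.card X : ℝ)) • Matrix.of fun _ _ => 1) := by
  have := S.nonempty_points
  have hn : (Fintype.card X : ℝ) ≠ 0 := by simp
  have hm := S.boseMesner.smul_mem S.allOnes_mem (1 / (Fintype.card X : ℝ))
  set K : Matrix X X ℝ := (1 / (Fintype.card X : ℝ)) • Matrix.of fun _ _ => 1 with hK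
  have hKi : K * K = K := by
    ext x y
    simp [hK, Matrix.mul_apply, hn]
  have hK0 : K ≠ 0 := by
    intro h
    have := congrFun (congrFun h (Classical.arbitrary X)) (Classical.arbitrary X)
    simp [hK] at this
  refine ⟨hm, hKi, hK0, fun G hG hi hJ => ?_⟩
  obtain ⟨c, hc⟩ := mul_allOnes hG
  have hG' : G = c • K := by
    rw [← hJ, mul_comm_of_mem hm hG, hK, mul_smul_comm, hc, smul_comm]
  rw [hG', smul_mul_smul_comm, hKi, ← sub_eq_zero, ← sub_smul, smul_eq_zero] at hi
  have hcc : c * (c - 1) = 0 := by linear_combination hi.resolve_right hK0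
  rcases mul_eq_zero.1 hcc with h | h
  · left
    rw [hG', h, zero_smul]
  · right
    rw [hG', sub_eq_zero.1 h, one_smul]

variable (S) in
lemma exists_isIdempotentEnumeration :
    ∃ E : Fin (d + 1) → Matrix X X ℝ, S.IsIdempotentEnumeration E := by
  have := S.nonempty_points
  have hn : (Fintype.card X : ℝ) ≠ 0 := by simp
  obtain ⟨e⟩ := S.exists_equiv_minimalIdempotents
  let i := e.symm ⟨_, S.isMinimalIdempotent_allOnes⟩
  -- The swap moves the trivial idempotent J/n to index 0.
  refine ⟨fun j => (e (Equiv.swap 0 i j)).1, ?_, ?_, ?_⟩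
  · exact Subtype.val_injective.comp (e.injective.comp (Equiv.injective _))
  · ext G
    constructor
    · rintro ⟨j, rfl⟩
      exact (e _).2
    · intro hG
      exact ⟨Equiv.swap 0 i (e.symm ⟨G, hG⟩), by simp⟩
  · simp [i, hn]

lemma exists_isKreinParameters {E : Fin (d + 1) → Matrix X X ℝ}
    (hE : S.IsIdempotentEnumeration E) : ∃ q, IsKreinParameters E q := by
  have := S.nonempty_points
  have hn : (Fintype.card X : ℝ) ≠ 0 := by simp
  have hmin (i) : S.IsMinimalIdempotent (E i) := hE.2.1.le (Set.mem_range_self i)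
  have h (i j) : ∃ c : Fin (d + 1) → ℝ, ∑ h, c h • E h = (Fintype.card X : ℝ) • (E i ⊙ E j) := by
    rw [← Submodule.mem_span_range_iff_exists_fun, hE.2.1, span_minimalIdempotents]
    exact S.boseMesner.smul_mem (hadamard_mem (hmin i).1 (hmin j).1) _
  choose q hq using h
  refine ⟨fun h i j => q i j h, fun i j => ?_⟩
  rw [hq, smul_smul, one_div_mul_cancel hn, one_smul]

end AssociationScheme

/-! ### A trace form of Cauchy–Schwarz. -/

namespace Matrix

variable {ι : Type*} [Fintype ι] [DecidableEq ι]

lemma trace_sub_smul_conj {A F : Matrix ι ι ℝ} (hA : A.IsHermitian) (hc : A * F = F * A)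
    (η : ℝ) : ((A - η • 1) * F * (A - η • 1)ᴴ).trace =
      (A * (A * F)).trace - 2 * η * (A * F).trace + η ^ 2 * F.trace := by
  have h : (A - η • 1) * F * (A - η • 1)ᴴ = A * (A * F) - (2 * η) • (A * F) + η ^ 2 • F := by
    rw [conjTranspose_sub, hA.eq, conjTranspose_smul, conjTranspose_one, star_trivial, sub_mul,
      smul_mul_assoc, one_mul, mul_sub, mul_smul_comm, mul_one, sub_mul, smul_mul_assoc,
      mul_assoc, ← hc]
    module
  rw [h, trace_add, trace_sub, trace_smul, trace_smul, smul_eq_mul, smul_eq_mul]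

/-- The Cauchy-Schwarz inequality for the first two moments of `A` with respect to `F`. -/
lemma PosSemidef.sq_trace_mul_le {A F : Matrix ι ι ℝ} (hF : F.PosSemidef) (hA : A.IsHermitian)
    (hc : A * F = F * A) (h0 : F ≠ 0) :
    (A * F).trace ^ 2 ≤ F.trace * (A * (A * F)).trace ∧
      ((A * F).trace ^ 2 = F.trace * (A * (A * F)).trace ↔ ∃ η : ℝ, A * F = η • F) := by
  have ht : 0 < F.trace :=
    hF.trace_nonneg.lt_of_ne' fun h => h0 (hF.trace_eq_zero_iff.1 h)
  -- The mean of A with respect to F; the trace of (A − η) F (A − η)ᴴ is then the variance times tr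
  -- F.
  set η := (A * F).trace / F.trace with hη
  have hη' : (A * F).trace = η * F.trace := by rw [hη, div_mul_cancel₀ _ ht.ne']
  have hpos := hF.mul_mul_conjTranspose_same (A - η • 1)
  have h1 := hpos.trace_nonneg
  rw [trace_sub_smul_conj hA hc, hη'] at h1
  refine ⟨by rw [hη']; nlinarith, fun h => ⟨η, ?_⟩, fun ⟨μ, hμ⟩ => ?_⟩
  · have h2 : ((A - η • 1) * F * (A - η • 1)ᴴ).trace = 0 := by
      rw [trace_sub_smul_conj hA hc, hη']
      rw [hη'] at h
      have := mul_left_cancel₀ ht.ne' (a := F.trace) (b := η ^ 2 * F.trace)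
        (c := (A * (A * F)).trace) (by linarith)
      linarith
    rw [hpos.trace_eq_zero_iff] at h2
    have hB : (A - η • 1)ᴴ = A - η • 1 := by
      rw [conjTranspose_sub, hA.eq, conjTranspose_smul, conjTranspose_one, star_trivial]
    have hBF : (A - η • 1) * F = F * (A - η • 1) := by
      rw [sub_mul, mul_sub, hc]
      simp
    -- With B = A − η commuting with F, this product is F(BFB), and BFB = 0.
    have hh : ((A - η • 1) * F) * ((A - η • 1) * F)ᴴ = 0 := by
      rw [hB] at h2
      rw [conjTranspose_mul, hF.isHermitian.eq, hB, hBF, mul_assoc, ← mul_assoc _ F, h2, mul_zero]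
    have h3 := self_mul_conjTranspose_eq_zero.1 hh
    rw [sub_mul, sub_eq_zero, smul_mul_assoc, one_mul] at h3
    exact h3
  · rw [hμ, mul_smul_comm, hμ]
    simp only [trace_smul, smul_eq_mul]
    ring

end Matrix

/-! ### Intersection numbers of a partially metric scheme, and the tail. -/

namespace AssociationScheme

variable {X : Type*} [Fintype X] {d : ℕ} (S : AssociationScheme X d)

lemma p_ne_zero_iff {h i j : Fin (d + 1)} :
    S.p h i j ≠ 0 ↔ ∃ x y z, S.idx x y = h ∧ S.idx x z = i ∧ S.idx z y = j := by
  constructor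
  · intro hp
    obtain ⟨x, y, rfl⟩ := S.exists_idx_eq h
    rw [← card_idx, Finset.card_ne_zero] at hp
    obtain ⟨z, hz⟩ := hp
    exact ⟨x, y, z, rfl, (Finset.mem_filter.1 hz).2⟩
  · rintro ⟨x, y, z, rfl, hz⟩
    rw [← card_idx, Finset.card_ne_zero]
    exact ⟨z, by simpa using hz⟩

/-- A triangle with sides h, i, j can be read from another side. This turns p²₁₁ ≠ 0 into b₁ ≠ 0. -/
lemma p_rotate_ne_zero {h i j : Fin (d + 1)} (hp : S.p h i j ≠ 0) : S.p j i h ≠ 0 := by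
  obtain ⟨x, y, z, h1, h2, h3⟩ := S.p_ne_zero_iff.1 hp
  exact S.p_ne_zero_iff.2 ⟨z, y, x, h3, S.idx_comm x z ▸ h2, h1⟩

lemma p_zero_of_ne {i j : Fin (d + 1)} (hij : i ≠ j) : S.p 0 i j = 0 := by
  by_contra hp
  obtain ⟨x, y, z, h1, h2, h3⟩ := S.p_ne_zero_iff.1 hp
  obtain rfl := S.idx_eq_zero.1 h1
  exact hij (h2.symm.trans ((S.idx_comm x z).trans h3))

lemma relMatrix_mul_relMatrix (i j : Fin (d + 1)) :
    S.relMatrix i * S.relMatrix j = S.ofFun fun h => (S.p h i j : ℝ) := by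
  rw [relMatrix_eq_ofFun _ j, relMatrix_mul_ofFun]
  simp [Pi.single_apply]

lemma p_right_zero (i : Fin (d + 1)) : S.p i i 0 = 1 := by
  classical
  have h := S.relMatrix_mul_relMatrix i 0
  rw [relMatrix_eq_ofFun _ 0, ← one_eq_ofFun, mul_one, relMatrix_eq_ofFun] at h
  have := congrFun (S.ofFun_injective h) i
  simp only [Pi.single_eq_same] at this
  exact_mod_cast this.symm

lemma sum_p (h i : Fin (d + 1)) : ∑ j, (S.p h i j : ℝ) = S.valency i := by
  have hm := S.relMatrix_mul_ofFun i 1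
  obtain ⟨x, y, rfl⟩ := S.exists_idx_eq h
  have h1 := congrFun (congrFun hm x) y
  have h2 := congrFun (congrFun hm x) x
  simp only [Matrix.mul_apply, ofFun_apply, Pi.one_apply, mul_one, idx_self] at h1 h2
  rw [← h1, h2, Finset.sum_eq_single i
    (fun j _ hj => by rw [S.p_zero_of_ne hj.symm, Nat.cast_zero]) (by simp), valency]

lemma trace_relMatrix_mul_ofFun (i : Fin (d + 1)) (f : Fin (d + 1) → ℝ) :
    (S.relMatrix i * S.ofFun f).trace = Fintype.card X * (S.valency i * f i) := by
  rw [relMatrix_mul_ofFun, trace_ofFun, Finset.sum_eq_single i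
    (fun j _ hj => by rw [S.p_zero_of_ne hj.symm, Nat.cast_zero, zero_mul]) (by simp), valency]

/-- The part of `n • (E ∘ E)` that is orthogonal to the trivial idempotent. -/
noncomputable def tail (E : Matrix X X ℝ) : Matrix X X ℝ :=
  (Fintype.card X : ℝ) • (E ⊙ E) -
    (E.rank : ℝ) • ((1 / (Fintype.card X : ℝ)) • Matrix.of fun _ _ => 1)

lemma tail_ofFun (e : Fin (d + 1) → ℝ) :
    tail (S.ofFun e) = S.ofFun fun i =>
      Fintype.card X * e i ^ 2 - (S.ofFun e).rank / Fintype.card X := by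
  ext x y
  simp [tail, pow_two, div_eq_mul_inv]

section

variable [DecidableEq X] {S}

/-- Numerals in `Fin (d + 1)` are reduced modulo d + 1, so the bound on d matters. -/
lemma val_one_two {d : ℕ} (hd : 2 ≤ d) :
    ((1 : Fin (d + 1)) : ℕ) = 1 ∧ ((2 : Fin (d + 1)) : ℕ) = 2 := by
  obtain ⟨e, rfl⟩ := Nat.exists_eq_add_of_le' hd
  exact ⟨rfl, rfl⟩

lemma IsTPartiallyMetric.one_ne (hS : S.IsTPartiallyMetric 2) :
    (1 : Fin (d + 1)) ≠ 0 ∧ (2 : Fin (d + 1)) ≠ 0 ∧ (2 : Fin (d + 1)) ≠ 1 := by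
  obtain ⟨h1, h2⟩ := val_one_two hS.1
  refine ⟨fun h => ?_, fun h => ?_, fun h => ?_⟩
  · simp [h] at h1
  · simp [h] at h2
  · rw [h, h1] at h2
    omega

/-- Compare coefficients in A₂ = c₀I + c₁A₁ + c₂A₁² with c₂ ≠ 0: at R₂ this reads c₂p²₁₁ = 1, and
outside R₀, R₁, R₂ it reads c₂pʰ₁₁ = 0. -/
lemma IsTPartiallyMetric.p_one_one (hS : S.IsTPartiallyMetric 2) :
    S.p 2 1 1 ≠ 0 ∧ ∀ h, S.p h 1 1 ≠ 0 → h = 0 ∨ h = 1 ∨ h = 2 := by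
  obtain ⟨h10, h20, h21⟩ := hS.one_ne
  obtain ⟨hd, -, hp⟩ := hS
  obtain ⟨h1, h2⟩ := val_one_two hd
  obtain ⟨f, hf, hA⟩ := hp 2 (by omega) (by omega)
  rw [h2] at hf
  have hlead : f.coeff 2 ≠ 0 := by
    rw [← hf, Polynomial.coeff_natDegree, Polynomial.leadingCoeff_ne_zero]
    rintro rfl
    simp at hf
  rw [Polynomial.aeval_eq_sum_range, hf] at hA
  simp only [Finset.sum_range_succ, Finset.range_zero, Finset.sum_empty, zero_add, pow_zero,
    pow_one, pow_two] at hA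
  rw [relMatrix_mul_relMatrix, relMatrix_eq_ofFun, relMatrix_eq_ofFun, one_eq_ofFun,
    ← map_smul, ← map_smul, ← map_smul, ← map_add, ← map_add] at hA
  have key := congrFun (S.ofFun_injective hA)
  constructor
  · intro h
    have := key 2
    simp [h, h20, h21] at this
  · intro h hh
    by_contra! hne
    have := key h
    simp [hne.1, hne.2.1, hne.2.2, hlead, hh] at this

lemma IsTPartiallyMetric.sum_p_one_one_mul (hS : S.IsTPartiallyMetric 2) (f : Fin (d + 1) → ℝ) :
    ∑ j, (S.p 1 1 j : ℝ) * f j = f 0 + S.p 1 1 1 * f 1 + S.p 1 1 2 * f 2 := by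
  obtain ⟨h10, h20, h21⟩ := hS.one_ne
  rw [← Finset.sum_subset (Finset.subset_univ {0, 1, 2}),
    Finset.sum_insert (by simp [h10.symm, h20.symm]), Finset.sum_pair h21.symm, p_right_zero, Nat.cast_one, one_mul, add_assoc]
  intro j _ hj
  by_contra hne
  have h1 : S.p 1 1 j ≠ 0 := fun h => hne (by rw [h, Nat.cast_zero, zero_mul])
  exact hj (by simpa using hS.p_one_one.2 j (S.p_rotate_ne_zero h1))

lemma IsTPartiallyMetric.trace_relMatrix_mul_mul (hS : S.IsTPartiallyMetric 2)
    (f : Fin (d + 1) → ℝ) : (S.relMatrix 1 * (S.relMatrix 1 * S.ofFun f)).trace =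
      Fintype.card X * (S.valency 1 * (f 0 + S.p 1 1 1 * f 1 + S.p 1 1 2 * f 2)) := by
  rw [relMatrix_mul_ofFun, trace_relMatrix_mul_ofFun, hS.sum_p_one_one_mul]

lemma posSemidef_of_idempotent {G : Matrix X X ℝ} (hG : G ∈ S.boseMesner) (hi : G * G = G) :
    G.PosSemidef := by
  have := Matrix.posSemidef_conjTranspose_mul_self G
  rwa [(isHermitian_of_mem hG).eq, hi] at this

lemma tail_mem {E : Matrix X X ℝ} (hE : E ∈ S.boseMesner) : tail E ∈ S.boseMesner := by
  obtain ⟨e, rfl⟩ := S.mem_boseMesner_iff.1 hE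
  exact S.mem_boseMesner_iff.2 ⟨_, S.tail_ofFun e⟩

lemma rank_eq_card_mul {e : Fin (d + 1) → ℝ} (hi : S.ofFun e * S.ofFun e = S.ofFun e) :
    ((S.ofFun e).rank : ℝ) = Fintype.card X * e 0 := by
  rw [← Matrix.trace_eq_rank_of_idempotent hi, trace_ofFun]

/-- A row sum of E ∘ E is a diagonal entry of E² = E, which is m/n. -/
lemma hadamard_mul_trivial {E : Matrix X X ℝ} (hE : E ∈ S.boseMesner) (hi : E * E = E) :
    (Fintype.card X : ℝ) • (E ⊙ E) * ((1 / (Fintype.card X : ℝ)) • Matrix.of fun _ _ => 1) =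
      (E.rank : ℝ) • ((1 / (Fintype.card X : ℝ)) • Matrix.of fun _ _ => 1) := by
  have := S.nonempty_points
  have hn : (Fintype.card X : ℝ) ≠ 0 := by simp
  obtain ⟨c, hc⟩ := mul_allOnes (hadamard_mem hE hE)
  obtain ⟨e, rfl⟩ := S.mem_boseMesner_iff.1 hE
  have hce : c = e 0 := by
    let x := Classical.arbitrary X
    have h1 := congrFun (congrFun hc x) x
    have h2 := congrFun (congrFun hi x) x
    simp only [Matrix.mul_apply, Matrix.hadamard_apply, ofFun_apply, Matrix.of_apply,
      Matrix.smul_apply, idx_self, smul_eq_mul, mul_one] at h1 h2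
    rw [← h1, ← h2]
    exact Finset.sum_congr rfl fun z _ => by rw [S.idx_comm z x]
  rw [smul_mul_assoc, mul_smul_comm, hc, rank_eq_card_mul hi, hce]
  module

/-- With K = J/n and W = n(E ∘ E), the tail is the compression (1 − K)W(1 − K), and W is positive
semidefinite by Schur. -/
lemma tail_posSemidef {E : Matrix X X ℝ} (hE : E ∈ S.boseMesner) (hi : E * E = E) :
    (tail E).PosSemidef := by
  have hK := S.isMinimalIdempotent_allOnes
  have hW := S.boseMesner.smul_mem (hadamard_mem hE hE) (Fintype.card X : ℝ)
  have hWK := hadamard_mul_trivial hE hi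
  have hWp : ((Fintype.card X : ℝ) • (E ⊙ E)).PosSemidef :=
    ((posSemidef_of_idempotent hE hi).hadamard (posSemidef_of_idempotent hE hi)).smul
      (Nat.cast_nonneg _)
  rw [tail]
  generalize (1 / (Fintype.card X : ℝ)) • (Matrix.of fun _ _ => 1 : Matrix X X ℝ) = K at *
  generalize (Fintype.card X : ℝ) • (E ⊙ E) = W at *
  have hKW : K * W = (E.rank : ℝ) • K := by rw [mul_comm_of_mem hK.1 hW, hWK]
  have h := hWp.mul_mul_conjTranspose_same (1 - K)
  rw [Matrix.conjTranspose_sub, Matrix.conjTranspose_one, (isHermitian_of_mem hK.1).eq, sub_mul,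
    one_mul, hKW, mul_sub, mul_one, sub_mul, hWK, smul_mul_assoc, hK.2.1, sub_self, sub_zero] at h
  exact h

/-- Multiplying the Krein expansion by E₀ leaves only the h = 0 term, so q⁰ⱼⱼ = m. Hence the sum
does not depend on the chosen enumeration. -/
lemma tail_eq_sum {Es : Fin (d + 1) → Matrix X X ℝ}
    {q : Fin (d + 1) → Fin (d + 1) → Fin (d + 1) → ℝ} (hEs : S.IsIdempotentEnumeration Es)
    (hq : IsKreinParameters Es q) (j : Fin (d + 1)) :
    ∑ h with h ≠ 0, q h j j • Es h = tail (Es j) := by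
  have := S.nonempty_points
  have hn : (Fintype.card X : ℝ) ≠ 0 := by simp
  have hmin (i) : S.IsMinimalIdempotent (Es i) := hEs.2.1.le (Set.mem_range_self i)
  have hW : (Fintype.card X : ℝ) • (Es j ⊙ Es j) = ∑ h, q h j j • Es h := by
    rw [hq, smul_smul, mul_one_div_cancel hn, one_smul]
  have hK : (1 / (Fintype.card X : ℝ)) • (Matrix.of fun _ _ => 1) = Es 0 := by
    rw [← hEs.2.2, smul_smul, one_div_mul_cancel hn, one_smul]
  have hWK := hadamard_mul_trivial (hmin j).1 (hmin j).2.1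
  rw [hK, hW, Finset.sum_mul, Finset.sum_eq_single 0 (fun i _ hi => by
    rw [smul_mul_assoc, (hmin i).mul_eq_zero (hmin 0) (hEs.1.ne hi), smul_zero]) (by simp),
    smul_mul_assoc, (hmin 0).2.1] at hWK
  rw [tail, hK, hW, ← hWK, Finset.filter_ne' Finset.univ 0,
    ← Finset.sum_erase_add _ _ (Finset.mem_univ 0), add_sub_cancel_right]

lemma isLightTail_iff {E : Matrix X X ℝ} (hE : S.IsMinimalIdempotent E) (h0 : tail E ≠ 0) :
    S.IsLightTail E ↔ ∃ η : ℝ, S.relMatrix 1 * tail E = η • tail E := by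
  constructor
  · rintro ⟨Es, q, j, hEs, hq, rfl, -, h⟩
    rwa [tail_eq_sum hEs hq] at h
  · intro h
    obtain ⟨Es, hEs⟩ := S.exists_isIdempotentEnumeration
    obtain ⟨q, hq⟩ := exists_isKreinParameters hEs
    obtain ⟨j, rfl⟩ := hEs.2.1.ge hE
    refine ⟨Es, q, j, hEs, hq, rfl, ?_⟩
    rw [tail_eq_sum hEs hq]
    exact ⟨h0, h⟩

end

/-- The Cauchy-Schwarz defect of the tail of an idempotent of multiplicity `m` and eigenvalue `t`
is a positive multiple of the defect of the bound on `m`. -/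
lemma tail_defect_eq {a b k m t : ℝ} (hk : k = 1 + a + b) (ha : a + 1 ≠ 0) (hb : b ≠ 0)
    (hk0 : k ≠ 0) (hD : ((a + 1) * t + k) ^ 2 + k * a * b ≠ 0) :
    (m ^ 2 - m) * (k * (m ^ 2 * (1 + a * (t / k) ^ 2 + b * ((t ^ 2 / k - 1 - a * t / k) / b) ^ 2)
      - m * k)) - (m ^ 2 * t ^ 2 / k - k * m) ^ 2 =
    m ^ 3 * (t - k) ^ 2 * (((a + 1) * t + k) ^ 2 + k * a * b) / (b * k ^ 2 * (a + 1)) *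
      (m - (k - k * (t + 1) ^ 2 * a * (a + 1) / (((a + 1) * t + k) ^ 2 + k * a * b))) := by
  -- The denominator D is cancelled as an atom, before its expression in a, k, t enters the
  -- computation.
  have h {c D N : ℝ} (hD : D ≠ 0) :
      c * D / (b * k ^ 2 * (a + 1)) * (m - (k - N / D)) =
        c / (b * k ^ 2 * (a + 1)) * (D * (m - k) + N) := by
    field_simp
    ring
  rw [h hD]
  clear hD h
  field_simp
  subst hk
  ring

end AssociationScheme

/-! ### The bound and its equality case. -/

open AssociationScheme

theorem mainTheorem5 {X : Type*} [Fintype X] [DecidableEq X] {d : ℕ}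
    (S : AssociationScheme X d) (hS : S.IsPartiallyMetric) (hrank : 3 ≤ d + 1)
    (k a₁ b₁ : ℝ) (hk : k = S.valency 1) (ha₁ : a₁ = S.p 1 1 1) (hb₁ : b₁ = S.p 1 1 2)
    (hk3 : 3 ≤ k)
    (E : Matrix X X ℝ) (hE : S.IsMinimalIdempotent E)
    (θ : ℝ) (hθ : S.relMatrix 1 * E = θ • E) (hθk : θ ≠ k) (hθk' : θ ≠ -k) :
    (E.rank : ℝ) ≥
        k - k * (θ + 1) ^ 2 * a₁ * (a₁ + 1) / (((a₁ + 1) * θ + k) ^ 2 + k * a₁ * b₁) ∧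
      ((E.rank : ℝ) =
          k - k * (θ + 1) ^ 2 * a₁ * (a₁ + 1) / (((a₁ + 1) * θ + k) ^ 2 + k * a₁ * b₁) ↔
        S.IsLightTail E) := by
  have := S.nonempty_points
  have hn : (Fintype.card X : ℝ) ≠ 0 := by simp
  have hS' : S.IsTPartiallyMetric 2 := hS.resolve_right (by omega)
  have hb : 0 < b₁ := by
    rw [hb₁, Nat.cast_pos]
    exact Nat.pos_of_ne_zero (S.p_rotate_ne_zero hS'.p_one_one.1)
  have ha : 0 ≤ a₁ := ha₁ ▸ Nat.cast_nonneg _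
  have hk0 : 0 < k := by linarith
  have hkab : k = 1 + a₁ + b₁ := by
    have := hS'.sum_p_one_one_mul 1
    simp only [Pi.one_apply, mul_one, sum_p] at this
    rw [hk, ha₁, hb₁, this]
  -- For a₁ = 0 this is (θ + k)², so θ ≠ −k is needed.
  have hD : 0 < ((a₁ + 1) * θ + k) ^ 2 + k * a₁ * b₁ := by
    rcases ha.eq_or_lt with h | h
    · rw [← h, zero_add, one_mul, mul_zero, zero_mul, add_zero]
      have : θ + k ≠ 0 := fun h => hθk' (by linarith)
      positivity
    · positivity
  have hEm := hE.1
  obtain ⟨e, rfl⟩ := S.mem_boseMesner_iff.1 hEm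
  have hi := hE.2.1
  have hA := isHermitian_of_mem (S.relMatrix_mem 1)
  have hF := tail_posSemidef hEm hi
  have hc := mul_comm_of_mem (S.relMatrix_mem 1) (tail_mem hEm)
  have hm := rank_eq_card_mul hi
  set m : ℝ := ((S.ofFun e).rank : ℝ) with hmdef
  have hm0 : 0 < m := by
    rw [hmdef, Nat.cast_pos]
    exact Nat.pos_of_ne_zero fun h => hE.2.2.1 (Matrix.eq_zero_of_rank_eq_zero h)
  have he0 : e 0 = m / Fintype.card X := by rw [hm, mul_div_cancel_left₀ _ hn]
  have hcoef : (fun h => ∑ j, (S.p h 1 j : ℝ) * e j) = θ • e := by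
    apply S.ofFun_injective
    rw [← relMatrix_mul_ofFun, hθ, map_smul]
  -- The trace of A₁E = θE gives k e₁ = θ e₀; its coefficient at R₁ then gives e₂, from e₀ + a₁e₁ +
  -- b₁e₂ = θe₁.
  have he1 : e 1 = θ / k * e 0 := by
    have := congrArg Matrix.trace hθ
    rw [trace_relMatrix_mul_ofFun, Matrix.trace_smul, trace_ofFun, ← hk, smul_eq_mul] at this
    have h2 : k * e 1 = θ * e 0 := mul_left_cancel₀ hn (by linarith)
    field_simp
    linarith
  have he2 : e 2 = (θ ^ 2 / k - 1 - a₁ * θ / k) / b₁ * e 0 := by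
    have := congrFun hcoef 1
    simp only [hS'.sum_p_one_one_mul, Pi.smul_apply, smul_eq_mul, ← ha₁, ← hb₁] at this
    rw [he1] at this
    field_simp
    field_simp at this
    linarith
  have ht0 : (tail (S.ofFun e)).trace = m ^ 2 - m := by
    rw [tail_ofFun, trace_ofFun, he0, ← hmdef]
    field_simp
  have ht1 : (S.relMatrix 1 * tail (S.ofFun e)).trace = m ^ 2 * θ ^ 2 / k - k * m := by
    rw [tail_ofFun, trace_relMatrix_mul_ofFun, he1, he0, ← hmdef, ← hk]
    field_simp
  have ht2 : (S.relMatrix 1 * (S.relMatrix 1 * tail (S.ofFun e))).trace =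
      k * (m ^ 2 * (1 + a₁ * (θ / k) ^ 2 + b₁ * ((θ ^ 2 / k - 1 - a₁ * θ / k) / b₁) ^ 2)
      - m * k) := by
    rw [tail_ofFun, hS'.trace_relMatrix_mul_mul, he2, he1, he0, ← hmdef, ← hk, ← ha₁, ← hb₁]
    field_simp
    rw [hkab]
    ring
  -- A zero tail has tr F = m² − m = 0, so m = 1, and then tr(A₁F) = 0 becomes θ² = k².
  have hF0 : tail (S.ofFun e) ≠ 0 := by
    intro h
    rw [h] at ht0 ht1
    rw [Matrix.trace_zero] at ht0
    rw [mul_zero, Matrix.trace_zero] at ht1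
    have hm1 : m = 1 := mul_left_cancel₀ hm0.ne' (by linarith)
    rw [hm1] at ht1
    field_simp at ht1
    have : (θ - k) * (θ + k) = 0 := by linarith
    rcases mul_eq_zero.1 this with h | h
    · exact hθk (by linarith)
    · exact hθk' (by linarith)
  obtain ⟨hle, heq⟩ := hF.sq_trace_mul_le hA hc hF0
  rw [isLightTail_iff hE hF0, ← heq]
  rw [ht0, ht1, ht2] at hle ⊢
  have hdef := tail_defect_eq (m := m) (t := θ) hkab (by positivity) hb.ne' hk0.ne' hD.ne'
  have hcpos : 0 < m ^ 3 * (θ - k) ^ 2 * (((a₁ + 1) * θ + k) ^ 2 + k * a₁ * b₁) /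
      (b₁ * k ^ 2 * (a₁ + 1)) := by
    have : 0 < (θ - k) ^ 2 := by
      have := sub_ne_zero.2 hθk
      positivity
    positivity
  constructor
  · have := nonneg_of_mul_nonneg_right (hdef ▸ sub_nonneg.2 hle) hcpos
    linarith
  · constructor
    · intro h
      rw [sub_eq_zero.2 h, mul_zero] at hdef
      linarith
    · intro h
      rw [h, sub_self] at hdef
      exact sub_eq_zero.1 ((mul_eq_zero.1 hdef.symm).resolve_left hcpos.ne')
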